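/- Let $k\ge 0$ be an integer, let $\mathcal P\subseteq\mathbb Z_{\ge 0}$, and work over a commutative ring $R\supseteq\mathbb Q$. Write $[n]=\{1,\dots,n\}$ and $\mathcal P-2=\{m\ge 0 : m+2\in\mathcal P\}$. For $\mathcal Q\subseteq\mathbb Z_{\ge0}$ let $e_{\mathcal Q}(z)=\sum_{m\in\mathcal Q}\frac{z^m}{m!}$, and let $e^z=\sum_{m\ge 0}\frac{z^m}{m!}$. In a rooted tree, the preimages of a node are its neighbours that are further from the root, and the height of the tree is the largest distance of a node from the root. Let $T^{\mathcal P}(z)$ be the exponential generating function, by number of vertices, of the labeled rooted trees (with vertex set $[n]$, for some $n$) in which the number of preimages of every node belongs to $\mathcal P$. For $h\in\mathbb Z$ let $T^{\mathcal P}_{\le h}(z)$ be the exponential generating function of those of height at most $h$ (so it is $0$ for $h<0$). Let $$F^{k,\mathcal P}(u,z)=\sum_{n\ge 0}\frac{z^n}{n!}\sum_{f} u^{\,n-|f^k([n])|},$$ where $f$ runs over the functions $f:[n]\to[n]$ with $|f^{-1}(x)|\in\mathcal P$ for every $x\in[n]$, and $f^k$ is the $k$th iterate of $f$. Let $P^{k,\mathcal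 P}(u,z)$ be the analogous series in which $f$ runs over the partial functions from $[n]$ to $[n]$ with $|f^{-1}(x)|\in\mathcal P$ for every $x\in[n]$. Put $F^{\mathcal P}(z)=F^{0,\mathcal P}(1,z)$, and $$\Xi^{k,\mathcal P}(z)=\Big(\frac{\partial}{\partial u}F^{k,\mathcal P}(u,z)\Big)\Big|_{u=1},\qquad \Xi^{\mathrm{partial},k,\mathcal P}(z)=\Big(\frac{\partial}{\partial u}P^{k,\mathcal P}(u,z)\Big)\Big|_{u=1}.$$ Thus $n!$ times the coefficient of $z^n$ in $\Xi^{k,\mathcal P}(z)$ (respectively in $\Xi^{\mathrm{partial},k,\mathcal P}(z)$) is the total number of points of $[n]$ not in $f^k([n])$, summed over all these functions (respectively partial functions) $f$. Then, as formal power series over $R$, $$\Xi^{k,\mathcal P}(z)=z\,T^{\mathcal P}_{\le k-1}(z)\,e_{\mathcal P-2}\big(T^{\mathcal P}(z)\big)\,F^{\mathcal P}(z)^3,$$ $$\Xi^{\mathrm{partial},k,\mathcal P}(z)=T^{\mathcal P}_{\le k-1}(z)\,F^{\mathcal P}(z)^2\,e^{T^{\mathcal P}(z)}\Big(z\,e_{\mathcal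 P-2}\big(T^{\mathcal P}(z)\big)\,F^{\mathcal P}(z)+1\Big).$$ -/

import Mathlib

noncomputable section

namespace PreimageConstraint

open PowerSeries

/-- The set `P - i`: subtract `i` from every element of `P` and keep the nonnegative results. -/
def shift (P : Set ℕ) (i : ℕ) : Set ℕ := {m | m + i ∈ P}

open Classical in
/-- The power series `e_P(z) = ∑_{n ∈ P} z ^ n / n!`. -/
def ePS (R : Type*) [CommRing R] [Algebra ℚ R] (P : Set ℕ) : R⟦X⟧ :=
  PowerSeries.mk fun n => if n ∈ P then algebraMap ℚ R (1 / n.factorial) else 0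

/-! ### Labeled rooted trees -/

/-- A labeled rooted tree of size `n`: a tree on the vertex set `Fin n`, which stands for
`{1, …, n}`, with a distinguished vertex. -/
structure RootedTree (n : ℕ) where
  graph : SimpleGraph (Fin n)
  isTree : graph.IsTree
  root : Fin n

namespace RootedTree

variable {n : ℕ}

/-- The preimages of a node `b`: the neighbours of `b` that are further from the root. -/
def preimages (t : RootedTree n) (b : Fin n) : Set (Fin n) :=
  {a | t.graph.Adj a b ∧ t.graph.dist t.root b < t.graph.dist t.root a}

/-- Every node has a number of preimages that lies in `P`. -/
def Constrained (P : Set ℕ) (t : RootedTree n) : Prop :=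
  ∀ b, (t.preimages b).ncard ∈ P

/-- The height of a rooted tree: the largest distance of a node from the root. -/
def height (t : RootedTree n) : ℕ :=
  Finset.univ.sup fun a => t.graph.dist t.root a

instance : Finite (RootedTree n) :=
  Finite.of_injective (β := SimpleGraph (Fin n) × Fin n) (fun t => (t.graph, t.root)) (by
    rintro ⟨G, hG, r⟩ ⟨G', hG', r'⟩ h
    simp only [Prod.mk.injEq] at h
    obtain ⟨rfl, rfl⟩ := h
    rfl)

end RootedTree

/-- `T^P(z)`: the exponential generating function of the `P`-constrained labeled rooted trees. -/
def treeGF (R : Type*) [CommRing R] [Algebra ℚ R] (P : Set ℕ) : R⟦X⟧ :=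
  PowerSeries.mk fun n => algebraMap ℚ R (1 / n.factorial) *
    (Nat.card {t : RootedTree n // t.Constrained P} : R)

/-- `T^P_{≤ h}(z)`: the exponential generating function of the `P`-constrained labeled rooted
trees of height at most `h`; it is `0` for `h < 0`. -/
def treeGFLe (R : Type*) [CommRing R] [Algebra ℚ R] (P : Set ℕ) (h : ℤ) : R⟦X⟧ :=
  PowerSeries.mk fun n => algebraMap ℚ R (1 / n.factorial) *
    (Nat.card {t : RootedTree n // t.Constrained P ∧ (t.height : ℤ) ≤ h} : R)

/-- There is no tree without vertices, so `T^P` can be substituted into every power series. -/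
theorem hasSubst_treeGF (R : Type*) [CommRing R] [Algebra ℚ R] (P : Set ℕ) :
    HasSubst (treeGF R P) := by
  apply HasSubst.of_constantCoeff_zero'
  have : IsEmpty {t : RootedTree 0 // t.Constrained P} := ⟨fun t => t.1.root.elim0⟩
  rw [← coeff_zero_eq_constantCoeff_apply, treeGF, coeff_mk, Nat.card_of_isEmpty]
  simp

/-! ### Functions -/

/-- Every point has a number of preimages under `f` that lies in `P`. -/
def FunConstrained (P : Set ℕ) {n : ℕ} (f : Fin n → Fin n) : Prop :=
  ∀ x, (f ⁻¹' {x}).ncard ∈ P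

open Classical in
/-- `F^{k,P}(u,z)`: the exponential generating function of the `P`-constrained functions from
`{1, …, n}` to itself, where `z` marks points and `u` marks points outside the image of the
`k`th iterate. It is a power series in `z` whose coefficients are polynomials in `u`. -/
def funGF (R : Type*) [CommRing R] [Algebra ℚ R] (k : ℕ) (P : Set ℕ) : (Polynomial R)⟦X⟧ :=
  PowerSeries.mk fun n => algebraMap ℚ (Polynomial R) (1 / n.factorial) *
    ∑ f : Fin n → Fin n with FunConstrained P f, Polynomial.X ^ ((Set.range f^[k])ᶜ).ncard

/-! ### Partial functions

A partial function on `{1, …, n}` is a map `Fin n → Option (Fin n)`, with the value `none` at the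
points that are not mapped anywhere. -/

/-- The `k`th iterate of a partial function. -/
def partialIter {n : ℕ} (f : Fin n → Option (Fin n)) : ℕ → Fin n → Option (Fin n)
  | 0 => some
  | k + 1 => fun x => (partialIter f k x).bind f

/-- The image of `{1, …, n}` under the `k`th iterate of a partial function. -/
def partialImage {n : ℕ} (f : Fin n → Option (Fin n)) (k : ℕ) : Set (Fin n) :=
  {y | ∃ x, partialIter f k x = some y}

/-- Every point has a number of preimages under the partial function `f` that lies in `P`. -/
def PartialConstrained (P : Set ℕ) {n : ℕ} (f : Fin n → Option (Fin n)) : Prop :=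
  ∀ x, (f ⁻¹' {some x}).ncard ∈ P

open Classical in
/-- `P^{k,P}(u,z)`: the exponential generating function of the `P`-constrained partial functions
on `{1, …, n}`, where `z` marks points and `u` marks points outside the image of the `k`th
iterate. -/
def partialGF (R : Type*) [CommRing R] [Algebra ℚ R] (k : ℕ) (P : Set ℕ) : (Polynomial R)⟦X⟧ :=
  PowerSeries.mk fun n => algebraMap ℚ (Polynomial R) (1 / n.factorial) *
    ∑ f : Fin n → Option (Fin n) with PartialConstrained P f,
      Polynomial.X ^ ((partialImage f k)ᶜ).ncard

/-! ### Specialization at `u = 1` -/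

/-- The value `A(1,z)`. -/
def evalOne {R : Type*} [CommRing R] (A : (Polynomial R)⟦X⟧) : R⟦X⟧ :=
  PowerSeries.map (Polynomial.evalRingHom 1) A

/-- The partial derivative `(∂/∂u) A(u,z)`, taken coefficientwise in `z`. -/
def derivU {R : Type*} [CommRing R] (A : (Polynomial R)⟦X⟧) : (Polynomial R)⟦X⟧ :=
  PowerSeries.mk fun n => Polynomial.derivative (PowerSeries.coeff n A)

/-- `F^P(z) = F^{0,P}(1,z)`. -/
def funGFOne (R : Type*) [CommRing R] [Algebra ℚ R] (P : Set ℕ) : R⟦X⟧ :=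
  evalOne (funGF R 0 P)

/-- `Ξ^{k,P}(z)`, the value at `u = 1` of `(∂/∂u) F^{k,P}(u,z)`. -/
def Xi (R : Type*) [CommRing R] [Algebra ℚ R] (k : ℕ) (P : Set ℕ) : R⟦X⟧ :=
  evalOne (derivU (funGF R k P))

/-- `Ξ^{partial,k,P}(z)`, the value at `u = 1` of `(∂/∂u) P^{k,P}(u,z)`. -/
def XiPartial (R : Type*) [CommRing R] [Algebra ℚ R] (k : ℕ) (P : Set ℕ) : R⟦X⟧ :=
  evalOne (derivU (partialGF R k P))

end PreimageConstraint

end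

open PreimageConstraint PowerSeries

/-! Both series count pairs (f, x) with x outside the image of the k-th iterate. Such an x lies on
no cycle, so the points that eventually reach x form a tree rooted at x, of height at most k - 1.
Cutting it off leaves a constrained partial function on the remaining points, with one extra
preimage reserved at f(x) if that is defined. This bijection (`exists_glue`, `card_branches_fiber`)
factors the count as T_{≤k-1} times a series for the rest.

By counting fibers, with φ = e_P, the rest has coefficients [tⁿ] ψ φⁿ (`lagrange`) or n [tⁿ] ψ φ'
φⁿ⁻¹ (`lagrangeDeriv`), where ψ is 1 for functions and exp for partial functions. If T = zφ(T) and F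
= `lagrange φ 1`, Lagrange inversion gives ψ(T)F for the first (`lagrange_eq`) and zψ'(T)φ'(T)F² +
zψ(T)φ''(T)F³ for the second (`lagrangeDeriv_eq`, `lagrangeDeriv_one_eq`).

That T^P is this fixed point follows from the same bijection: cutting the tree of the only undefined
point shows T^P · F = `lagrange φ X` = T · F, and F is a unit (`treeGF_fixed`). -/

namespace PreimageConstraint

/-! ### Lagrange inversion by linear operators on power series -/

section Lagrange

variable {R : Type*} [CommRing R]

/-- The series `∑ zⁿ [tⁿ] ψ(t) φ(t)ⁿ`, as a linear function of `ψ`. -/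
noncomputable def lagrange (φ : R⟦X⟧) : R⟦X⟧ →ₗ[R] R⟦X⟧ where
  toFun ψ := mk fun n => coeff n (ψ * φ ^ n)
  map_add' a b := by ext n; simp [add_mul]
  map_smul' r a := by ext n; simp

/-- The series `∑ zⁿ n [tⁿ] ψ(t) φ'(t) φ(t)ⁿ⁻¹`, as a linear function of `ψ`. -/
noncomputable def lagrangeDeriv (φ : R⟦X⟧) : R⟦X⟧ →ₗ[R] R⟦X⟧ where
  toFun ψ := mk fun n => (n : R) * coeff n (ψ * d⁄dX R φ * φ ^ (n - 1))
  map_add' a b := by ext n; simp [add_mul, mul_add]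
  map_smul' r a := by ext n; simp [mul_left_comm]

theorem coeff_lagrange (φ ψ : R⟦X⟧) (n : ℕ) :
    coeff n (lagrange φ ψ) = coeff n (ψ * φ ^ n) := by
  simp [lagrange]

theorem coeff_lagrangeDeriv (φ ψ : R⟦X⟧) (n : ℕ) :
    coeff n (lagrangeDeriv φ ψ) = (n : R) * coeff n (ψ * d⁄dX R φ * φ ^ (n - 1)) := by
  simp [lagrangeDeriv]

theorem lagrange_X_mul (φ ψ : R⟦X⟧) : lagrange φ (X * ψ) = X * lagrange φ (φ * ψ) := by
  ext n
  cases n with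
  | zero => simp [coeff_lagrange]
  | succ n =>
    rw [coeff_lagrange, mul_assoc, coeff_succ_X_mul, coeff_succ_X_mul, coeff_lagrange, pow_succ]
    ring_nf

theorem lagrangeDeriv_X_mul (φ ψ : R⟦X⟧) :
    lagrangeDeriv φ (X * ψ) =
      X * lagrangeDeriv φ (φ * ψ) + X * lagrange φ (d⁄dX R φ * ψ) := by
  ext n
  cases n with
  | zero => simp [coeff_lagrangeDeriv]
  | succ n =>
    rw [coeff_lagrangeDeriv, mul_assoc, mul_assoc, coeff_succ_X_mul, map_add, coeff_succ_X_mul,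
      coeff_succ_X_mul, coeff_lagrange, coeff_lagrangeDeriv]
    -- The factor n kills the case n = 0, where the truncated exponent n - 1 is wrong.
    have h : (n : R) * coeff n (φ * ψ * d⁄dX R φ * φ ^ (n - 1)) =
        n * coeff n (d⁄dX R φ * ψ * φ ^ n) := by
      cases n with
      | zero => simp
      | succ m => rw [Nat.add_sub_cancel, pow_succ]; ring_nf
    rw [h, Nat.add_sub_cancel]
    push_cast
    ring_nf

theorem coeff_derivative_mul_pow [Algebra ℚ R] (φ : R⟦X⟧) (n : ℕ) :
    coeff n (d⁄dX R φ * φ ^ n) = coeff (n + 1) (φ ^ (n + 1)) := by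
  have h := coeff_derivative (φ ^ (n + 1)) n
  rw [derivative_pow, Nat.add_sub_cancel] at h
  have hn : IsUnit ((n : R) + 1) := by
    have := (IsUnit.mk0 ((n : ℚ) + 1) (by positivity)).map (algebraMap ℚ R)
    simpa using this
  apply hn.mul_left_cancel
  rw [mul_comm _ (coeff (n + 1) _), ← h, show ((n + 1 : ℕ) : R⟦X⟧) = C ((n : R) + 1) by simp,
    mul_assoc, coeff_C_mul, mul_comm (φ ^ n)]

theorem lagrange_one_sub [Algebra ℚ R] (φ : R⟦X⟧) :
    lagrange φ 1 = 1 + X * lagrange φ (d⁄dX R φ) := by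
  ext n
  cases n with
  | zero => simp [coeff_lagrange]
  | succ n =>
    rw [map_add, coeff_succ_X_mul, coeff_lagrange, coeff_lagrange, coeff_derivative_mul_pow,
      one_mul]
    simp [coeff_one]

/-- The factor n + 1 turns the coefficient of tⁿ⁺¹ in φ'φⁿ into the coefficient of tⁿ in its
derivative; the product rule yields the two terms. -/
theorem lagrangeDeriv_one (φ : R⟦X⟧) :
    lagrangeDeriv φ 1 =
      X * (lagrangeDeriv φ (d⁄dX R φ) + lagrange φ (d⁄dX R (d⁄dX R φ))) := by
  ext n
  cases n with
  | zero => simp [coeff_lagrangeDeriv]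
  | succ n =>
    rw [coeff_succ_X_mul, map_add, coeff_lagrange, coeff_lagrangeDeriv, coeff_lagrangeDeriv,
      one_mul, Nat.add_sub_cancel]
    have h := coeff_derivative (d⁄dX R φ * φ ^ n) n
    rw [Derivation.leibniz, derivative_pow] at h
    push_cast
    rw [mul_comm, ← h, map_add, smul_eq_mul, smul_eq_mul]
    congr 1
    · rw [show (n : R⟦X⟧) = C (n : R) by simp, ← coeff_C_mul]
      ring_nf
    · rw [mul_comm]

/-- Uniqueness principle behind the inversion formulas: splitting off the constant term of ψ gives E
ψ = X · E χ for some χ, and repeating this makes E ψ divisible by every power of X. -/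
theorem eq_zero_of_X_mul (φ : R⟦X⟧) (E : R⟦X⟧ →ₗ[R] R⟦X⟧) (h1 : E 1 = 0)
    (hX : ∀ ψ, E (X * ψ) = X * E (φ * ψ)) (ψ : R⟦X⟧) : E ψ = 0 := by
  have key : ∀ (n : ℕ) (ψ : R⟦X⟧), coeff n (E ψ) = 0 := by
    intro n
    have hE : ∀ ψ : R⟦X⟧, ∃ χ, E ψ = X * E χ := by
      intro ψ
      refine ⟨φ * mk fun p => coeff (p + 1) ψ, ?_⟩
      rw [← hX]
      conv_lhs => rw [eq_X_mul_shift_add_const ψ]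
      rw [map_add, show (C (constantCoeff ψ) : R⟦X⟧) = constantCoeff ψ • 1 by
        rw [smul_eq_C_mul, mul_one], map_smul, h1, smul_zero, add_zero]
    induction n with
    | zero => intro ψ; obtain ⟨χ, h⟩ := hE ψ; simp [h]
    | succ n ih => intro ψ; obtain ⟨χ, h⟩ := hE ψ; rw [h, coeff_succ_X_mul, ih]
  ext n
  rw [key]; simp

section Fixed

variable {φ T : R⟦X⟧}

theorem hasSubst_of_fixed (hT : T = X * φ.subst T) : HasSubst T :=
  HasSubst.of_constantCoeff_zero' (by rw [hT]; simp)

/-- As functions of ψ, both sides are linear, agree at 1 and, because T = X φ(T), obey the same rule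
for multiplication by X. -/
theorem lagrange_eq (hT : T = X * φ.subst T) (ψ : R⟦X⟧) :
    lagrange φ ψ = ψ.subst T * lagrange φ 1 := by
  have hS := hasSubst_of_fixed hT
  have := eq_zero_of_X_mul φ
    (lagrange φ - (LinearMap.mulRight R (lagrange φ 1)).comp (substAlgHom hS).toLinearMap)
    (by simp) (fun ψ => by
      simp only [LinearMap.sub_apply, LinearMap.comp_apply, LinearMap.mulRight_apply,
        AlgHom.toLinearMap_apply, map_mul, substAlgHom_X, coe_substAlgHom, lagrange_X_mul]
      linear_combination (-(ψ.subst T) * lagrange φ 1) * hT) ψ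
  simpa only [LinearMap.sub_apply, LinearMap.comp_apply, LinearMap.mulRight_apply,
    AlgHom.toLinearMap_apply, coe_substAlgHom, sub_eq_zero] using this

theorem lagrange_one_mul [Algebra ℚ R] (hT : T = X * φ.subst T) :
    lagrange φ 1 = 1 + X * (d⁄dX R φ).subst T * lagrange φ 1 := by
  conv_lhs => rw [lagrange_one_sub, lagrange_eq hT]
  ring

theorem lagrangeDeriv_eq [Algebra ℚ R] (hT : T = X * φ.subst T) (ψ : R⟦X⟧) :
    lagrangeDeriv φ ψ =
      (d⁄dX R ψ).subst T * (X * (d⁄dX R φ).subst T * lagrange φ 1 ^ 2) +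
        ψ.subst T * lagrangeDeriv φ 1 := by
  have hS := hasSubst_of_fixed hT
  have hF := lagrange_one_mul hT
  have := eq_zero_of_X_mul φ
    (lagrangeDeriv φ -
      (LinearMap.mulRight R (X * (d⁄dX R φ).subst T * lagrange φ 1 ^ 2)).comp
        ((substAlgHom hS).toLinearMap.comp (d⁄dX R).toLinearMap) -
      (LinearMap.mulRight R (lagrangeDeriv φ 1)).comp (substAlgHom hS).toLinearMap)
    (by simp) (fun ψ => by
      simp only [LinearMap.sub_apply, LinearMap.comp_apply, LinearMap.mulRight_apply,
        AlgHom.toLinearMap_apply, map_mul, map_add, substAlgHom_X, coe_substAlgHom,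
        lagrangeDeriv_X_mul, Derivation.coeFn_coe, Derivation.leibniz, smul_eq_mul,
        derivative_X, mul_one, lagrange_eq hT (_ * ψ), subst_mul hS]
      generalize lagrange φ 1 = F at *
      generalize (d⁄dX R φ).subst T = a at *
      generalize (d⁄dX R ψ).subst T = b at *
      generalize φ.subst T = c at *
      generalize ψ.subst T = d at *
      linear_combination (-b * X * a * F ^ 2 - d * lagrangeDeriv φ 1) * hT -
        d * X * a * F * hF) ψ
  rw [← sub_eq_zero, ← this]
  simp only [LinearMap.sub_apply, LinearMap.comp_apply, LinearMap.mulRight_apply,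
        AlgHom.toLinearMap_apply, coe_substAlgHom, Derivation.coeFn_coe]
  ring

theorem isUnit_lagrange_one (φ : R⟦X⟧) : IsUnit (lagrange φ 1) := by
  rw [isUnit_iff_constantCoeff, ← coeff_zero_eq_constantCoeff_apply, coeff_lagrange]
  simp

/-- Taking ψ = φ' in `lagrangeDeriv_eq` makes `lagrangeDeriv_one` a linear equation for the unknown
series; it is solved by (1 - Xφ'(T))F = 1. -/
theorem lagrangeDeriv_one_eq [Algebra ℚ R] (hT : T = X * φ.subst T) :
    lagrangeDeriv φ 1 = X * (d⁄dX R (d⁄dX R φ)).subst T * lagrange φ 1 ^ 3 := by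
  have h := lagrangeDeriv_one φ
  rw [lagrangeDeriv_eq hT (d⁄dX R φ), lagrange_eq hT (d⁄dX R (d⁄dX R φ))] at h
  have hF := lagrange_one_mul hT
  generalize lagrange φ 1 = F at *
  generalize (d⁄dX R φ).subst T = a at *
  generalize (d⁄dX R (d⁄dX R φ)).subst T = b at *
  generalize lagrangeDeriv φ 1 = m at *
  linear_combination F * h - (X * b * F ^ 2 + m) * hF

end Fixed

theorem X_pow_dvd_subst_sub (φ : R⟦X⟧) {a b : R⟦X⟧} (ha : HasSubst a) (hb : HasSubst b) {k : ℕ}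
    (h : X ^ k ∣ a - b) : X ^ k ∣ (φ.subst a - φ.subst b : R⟦X⟧) := by
  rw [X_pow_dvd_iff]
  intro m hm
  rw [map_sub, coeff_subst' ha, coeff_subst' hb, sub_eq_zero]
  refine finsum_congr fun d => ?_
  have := X_pow_dvd_iff.1 (h.trans (sub_dvd_pow_sub_pow a b d)) m hm
  rw [map_sub, sub_eq_zero] at this
  rw [this]

/-- Iterating T ↦ X φ(T) from 0 converges X-adically: each step fixes one more coefficient. -/
theorem exists_fixed (φ : R⟦X⟧) : ∃ T : R⟦X⟧, T = X * φ.subst T := by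
  obtain ⟨s, hs0, hs⟩ : ∃ s : ℕ → R⟦X⟧, s 0 = 0 ∧ ∀ k, s (k + 1) = X * φ.subst (s k) :=
    ⟨fun k => (fun T : R⟦X⟧ => X * φ.subst T)^[k] 0, rfl,
      fun k => Function.iterate_succ_apply' _ _ _⟩
  have hS : ∀ k, HasSubst (s k) := by
    intro k
    cases k with
    | zero => rw [hs0]; exact HasSubst.zero'
    | succ k => exact HasSubst.of_constantCoeff_zero' (by rw [hs]; simp)
  have hd : ∀ k, X ^ k ∣ s (k + 1) - s k := by
    intro k
    induction k with
    | zero => simp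
    | succ k ih =>
      have h : s (k + 1 + 1) - s (k + 1) =
          X * (φ.subst (s (k + 1)) - φ.subst (s k) : R⟦X⟧) := by
        rw [mul_sub, ← hs, ← hs]
      rw [h, pow_succ']
      exact mul_dvd_mul_left X (X_pow_dvd_subst_sub φ (hS (k + 1)) (hS k) ih)
  have hd' : ∀ k j, X ^ k ∣ s (k + j) - s k := by
    intro k j
    induction j with
    | zero => simp
    | succ j ih =>
      have := dvd_add ((pow_dvd_pow X (Nat.le_add_right k j)).trans (hd (k + j))) ih
      simpa [add_assoc] using this
  -- The coefficient of index n is stable from the iterate n + 1 on.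
  let T : R⟦X⟧ := mk fun n => coeff n (s (n + 1))
  have hT : ∀ k, X ^ k ∣ T - s k := by
    intro k
    rw [X_pow_dvd_iff]
    intro m hm
    obtain ⟨j, rfl⟩ := Nat.exists_eq_add_of_le (Nat.succ_le_of_lt hm)
    have := X_pow_dvd_iff.1 (hd' (m + 1) j) m (Nat.lt_succ_self m)
    rw [map_sub, sub_eq_zero] at this ⊢
    rw [coeff_mk]
    exact this.symm
  have hTS : HasSubst T := HasSubst.of_constantCoeff_zero' (by
    rw [← coeff_zero_eq_constantCoeff_apply, coeff_mk, hs]; simp)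
  refine ⟨T, ?_⟩
  rw [← sub_eq_zero]
  ext m
  have h1 := hT (m + 1)
  rw [hs] at h1
  have h4 : X ^ (m + 1) ∣ X * (φ.subst T - φ.subst (s m)) := by
    rw [pow_succ']
    exact mul_dvd_mul_left _ (X_pow_dvd_subst_sub φ hTS (hS m) (hT m))
  have := X_pow_dvd_iff.1 (dvd_sub h1 h4) m (Nat.lt_succ_self m)
  rw [map_zero, ← this]
  congr 1
  ring

end Lagrange

/-! ### Exponential generating functions and fiber sizes -/

theorem derivative_prod {R κ : Type*} [CommRing R] [DecidableEq κ] (s : Finset κ)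
    (a : κ → R⟦X⟧) :
    d⁄dX R (∏ y ∈ s, a y) = ∑ y ∈ s, (∏ z ∈ s.erase y, a z) * d⁄dX R (a y) := by
  induction s using Finset.induction_on with
  | empty => simp
  | insert x s hx ih =>
    rw [Finset.prod_insert hx, Derivation.leibniz, ih, Finset.sum_insert hx,
      Finset.erase_insert hx, smul_eq_mul, smul_eq_mul, add_comm, Finset.mul_sum]
    congr 1
    refine Finset.sum_congr rfl fun y hy => ?_
    rw [Finset.erase_insert_of_ne (ne_of_mem_of_not_mem hy hx).symm,
      Finset.prod_insert (fun h => hx (Finset.mem_of_mem_erase h)), mul_assoc]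

theorem factorial_mul_coeff_derivative {R : Type*} [CommRing R] (A : R⟦X⟧) (n : ℕ) :
    (n.factorial : R) * coeff n (d⁄dX R A) = (n + 1).factorial * coeff (n + 1) A := by
  rw [coeff_derivative, Nat.factorial_succ]
  push_cast
  ring

section Weights

variable {R : Type*} [CommRing R] [Algebra ℚ R]

/-- The exponential generating function of a sequence. -/
noncomputable def egf (w : ℕ → R) : R⟦X⟧ :=
  mk fun n => algebraMap ℚ R (1 / n.factorial) * w n

theorem factorial_mul_algebraMap (n : ℕ) :
    (n.factorial : R) * algebraMap ℚ R (1 / n.factorial) = 1 := by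
  rw [← map_natCast (algebraMap ℚ R), ← map_mul, mul_one_div_cancel, map_one]
  exact_mod_cast n.factorial_ne_zero

theorem factorial_mul_coeff_egf (w : ℕ → R) (n : ℕ) :
    (n.factorial : R) * coeff n (egf w) = w n := by
  rw [egf, coeff_mk, ← mul_assoc, factorial_mul_algebraMap, one_mul]

theorem eq_of_factorial_mul_eq {n : ℕ} {a b : R}
    (h : (n.factorial : R) * a = n.factorial * b) : a = b := by
  have := congrArg (algebraMap ℚ R (1 / n.factorial) * ·) h
  simpa only [← mul_assoc, mul_comm (algebraMap ℚ R _) (n.factorial : R),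
    factorial_mul_algebraMap, one_mul] using this

theorem eq_egf_of_factorial_mul {w : ℕ → R} {A : R⟦X⟧}
    (h : ∀ n, (n.factorial : R) * coeff n A = w n) : A = egf w := by
  ext n
  apply eq_of_factorial_mul_eq (n := n)
  rw [h, factorial_mul_coeff_egf]

theorem derivative_egf (w : ℕ → R) : d⁄dX R (egf w) = egf fun n => w (n + 1) :=
  eq_egf_of_factorial_mul fun n => by
    rw [factorial_mul_coeff_derivative, factorial_mul_coeff_egf]

theorem factorial_mul_coeff_egf_mul (a b : ℕ → R) (n : ℕ) :
    (n.factorial : R) * coeff n (egf a * egf b) =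
      ∑ S : Finset (Fin n), a S.card * b (n - S.card) := by
  rw [← Finset.powerset_univ, Finset.sum_powerset_apply_card (fun m => a m * b (n - m)),
    Finset.card_univ, Fintype.card_fin, coeff_mul,
    Finset.Nat.sum_antidiagonal_eq_sum_range_succ (fun i j => coeff i (egf a) * coeff j (egf b)),
    Finset.mul_sum]
  refine Finset.sum_congr rfl fun m hm => ?_
  have hm : m ≤ n := Nat.lt_succ_iff.1 (Finset.mem_range.1 hm)
  rw [← factorial_mul_coeff_egf a m, ← factorial_mul_coeff_egf b (n - m),
    ← Nat.choose_mul_factorial_mul_factorial hm, nsmul_eq_mul]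
  push_cast
  ring

/-- Induction on n: sending the first point to y₀ shifts the weight sequence of y₀, which
differentiates its generating function. Summing over y₀ is the product rule. -/
theorem sum_fin_prod_card_fiber {κ : Type*} [Fintype κ] [DecidableEq κ] (n : ℕ)
    (w : κ → ℕ → R) :
    ∑ f : Fin n → κ, ∏ y, w y (Finset.univ.filter fun i => f i = y).card =
      (n.factorial : R) * coeff n (∏ y, egf (w y)) := by
  induction n generalizing w with
  | zero =>
    simp [map_prod, egf]
  | succ n ih =>
    rw [← factorial_mul_coeff_derivative, derivative_prod, map_sum, Finset.mul_sum,
      ← (Fin.consEquiv fun _ : Fin (n + 1) => κ).sum_comp, Fintype.sum_prod_type]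
    refine Finset.sum_congr rfl fun y₀ _ => ?_
    have h1 : (∏ y ∈ Finset.univ.erase y₀, egf (w y)) * d⁄dX R (egf (w y₀)) =
        ∏ y, egf (Function.update w y₀ (fun m => w y₀ (m + 1)) y) := by
      rw [← Finset.prod_erase_mul _ _ (Finset.mem_univ y₀), Function.update_self,
        derivative_egf]
      congr 1
      refine Finset.prod_congr rfl fun y hy => ?_
      rw [Function.update_of_ne (Finset.ne_of_mem_erase hy)]
    rw [h1, ← ih]
    refine Finset.sum_congr rfl fun f _ => Finset.prod_congr rfl fun y _ => ?_
    rw [Fin.card_filter_univ_succ]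
    by_cases hy : y = y₀
    · subst hy; simp
    · simp [hy, Ne.symm hy]

theorem sum_prod_card_fiber {ι κ : Type*} [Fintype ι] [DecidableEq ι] [Fintype κ]
    [DecidableEq κ]
    (w : κ → ℕ → R) :
    ∑ f : ι → κ, ∏ y, w y (Finset.univ.filter fun i => f i = y).card =
      ((Fintype.card ι).factorial : R) * coeff (Fintype.card ι) (∏ y, egf (w y)) := by
  rw [← sum_fin_prod_card_fiber, ← ((Fintype.equivFin ι).arrowCongr (Equiv.refl κ)).sum_comp]
  refine Finset.sum_congr rfl fun f _ => Finset.prod_congr rfl fun y _ => ?_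
  congr 1
  refine Finset.card_equiv (Fintype.equivFin ι) fun i => ?_
  simp

open Classical in
theorem ePS_eq_egf (P : Set ℕ) : ePS R P = egf fun n => if n ∈ P then 1 else 0 := by
  ext n
  simp [ePS, egf]

theorem derivative_ePS (P : Set ℕ) : d⁄dX R (ePS R P) = ePS R (shift P 1) := by
  rw [ePS_eq_egf, ePS_eq_egf, derivative_egf]
  rfl

theorem derivative_derivative_ePS (P : Set ℕ) :
    d⁄dX R (d⁄dX R (ePS R P)) = ePS R (shift P 2) := by
  rw [derivative_ePS, derivative_ePS]
  rfl

theorem ePS_singleton_zero : ePS R {0} = 1 := by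
  ext n
  cases n <;> simp [ePS, coeff_one]

theorem ePS_singleton_one : ePS R {1} = X := by
  ext n
  rw [ePS, coeff_mk, coeff_X]
  by_cases h : n = 1
  · simp [h]
  · simp [h]

theorem ePS_univ : ePS R Set.univ = exp R := by
  ext n
  simp [ePS, coeff_exp]

theorem card_fibers_mem {ι κ : Type*} [Fintype ι] [Fintype κ] (Q : κ → Set ℕ) :
    (Nat.card {f : ι → κ // ∀ y, (f ⁻¹' {y}).ncard ∈ Q y} : R) =
      ((Fintype.card ι).factorial : R) * coeff (Fintype.card ι) (∏ y, ePS R (Q y)) := by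
  classical
  simp_rw [ePS_eq_egf]
  rw [← sum_prod_card_fiber, Nat.card_eq_fintype_card, Fintype.card_subtype,
    ← Finset.sum_boole]
  refine Finset.sum_congr rfl fun f _ => ?_
  have h : ∀ y, (f ⁻¹' {y}).ncard = (Finset.univ.filter fun i => f i = y).card := fun y => by
    rw [← Set.ncard_coe_finset]
    congr 1
    ext i
    simp
  simp_rw [h, Finset.prod_boole, Finset.mem_univ, true_imp_iff]

/-- The partial functions with constrained fibers and a constrained number of points on which
they are undefined. -/
theorem card_partial_fibers_mem {γ : Type*} [Fintype γ] (P Q : Set ℕ) :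
    (Nat.card {f : γ → Option γ // (f ⁻¹' {none}).ncard ∈ Q ∧
        ∀ y, (f ⁻¹' {some y}).ncard ∈ P} : R) =
      ((Fintype.card γ).factorial : R) *
        coeff (Fintype.card γ) (lagrange (ePS R P) (ePS R Q)) := by
  have := card_fibers_mem (R := R) (ι := γ) (κ := Option γ) fun y => y.elim Q fun _ => P
  simp only [Option.forall, Option.elim] at this
  rw [this, Fintype.prod_option, coeff_lagrange]
  simp

/-- The partial functions with constrained fibers, where one additional preimage is counted at a
distinguished point. -/
theorem card_partial_fibers_mem_pointed {γ : Type*} [Fintype γ] [DecidableEq γ] (P Q : Set ℕ) :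
    (Nat.card {p : (γ → Option γ) × γ // (p.1 ⁻¹' {none}).ncard ∈ Q ∧
        ∀ y, (p.1 ⁻¹' {some y}).ncard + (if p.2 = y then 1 else 0) ∈ P} : R) =
      ((Fintype.card γ).factorial : R) *
        coeff (Fintype.card γ) (lagrangeDeriv (ePS R P) (ePS R Q)) := by
  have h1 : ∀ y₀ : γ, (Nat.card {f : γ → Option γ // (f ⁻¹' {none}).ncard ∈ Q ∧
      ∀ y, (f ⁻¹' {some y}).ncard + (if y₀ = y then 1 else 0) ∈ P} : R) =
      ((Fintype.card γ).factorial : R) * coeff (Fintype.card γ)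
        (ePS R Q * d⁄dX R (ePS R P) * ePS R P ^ (Fintype.card γ - 1)) := by
    intro y₀
    have := card_fibers_mem (R := R) (ι := γ) (κ := Option γ)
      fun y => y.elim Q fun y => shift P (if y₀ = y then 1 else 0)
    simp only [Option.forall, Option.elim] at this
    simp only [shift, Set.mem_ofPred_eq] at this
    rw [this, Fintype.prod_option, ← Finset.mul_prod_erase _ _ (Finset.mem_univ y₀),
      Finset.prod_congr rfl (g := fun _ => ePS R P) fun y hy => by
        simp [(Finset.ne_of_mem_erase hy).symm], Finset.prod_const,
      Finset.card_erase_of_mem (Finset.mem_univ _), derivative_ePS, mul_assoc]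
    simp [shift]
  have e : {p : (γ → Option γ) × γ // (p.1 ⁻¹' {none}).ncard ∈ Q ∧
        ∀ y, (p.1 ⁻¹' {some y}).ncard + (if p.2 = y then 1 else 0) ∈ P} ≃
      Σ y₀ : γ, {f : γ → Option γ // (f ⁻¹' {none}).ncard ∈ Q ∧
      ∀ y, (f ⁻¹' {some y}).ncard + (if y₀ = y then 1 else 0) ∈ P} :=
    ⟨fun p => ⟨p.1.2, p.1.1, p.2⟩, fun q => ⟨(q.2.1, q.1), q.2.2⟩, fun _ => rfl, fun _ => rfl⟩
  rw [Nat.card_congr e, Nat.card_sigma]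
  push_cast
  rw [Finset.sum_congr rfl fun y _ => h1 y, Finset.sum_const, Finset.card_univ, nsmul_eq_mul,
    coeff_lagrangeDeriv]
  ring

end Weights

/-! ### Partial functions, their iterates and parent functions -/

section Iterates

variable {α β : Type*}

/-- One step of a partial function, starting from a point that may already be lost. -/
def step (f : α → Option α) (o : Option α) : Option α := o.bind f

@[simp] theorem step_some (f : α → Option α) (a : α) : step f (some a) = f a := rfl

@[simp] theorem step_none (f : α → Option α) : step f none = none := rfl

@[simp] theorem step_iterate_none (f : α → Option α) (j : ℕ) : (step f)^[j] none = none :=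
  Function.iterate_fixed (step_none f) j

theorem step_iterate_succ_some (f : α → Option α) (j : ℕ) (a : α) :
    (step f)^[j + 1] (some a) = (step f)^[j] (f a) := by
  rw [Function.iterate_succ_apply, step_some]

theorem step_iterate_succ_eq_some {f : α → Option α} {j : ℕ} {a b : α} :
    (step f)^[j + 1] (some a) = some b ↔
      ∃ c, (step f)^[j] (some a) = some c ∧ f c = some b := by
  rw [Function.iterate_succ_apply', step, Option.bind_eq_some_iff]

/-- `g` is the parent function of a tree with root `r`. -/
def IsParent (g : α → Option α) (r : α) : Prop :=
  g r = none ∧ ∀ a, ∃ j, (step g)^[j] (some a) = some r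

theorem IsParent.eq_none_iff {g : α → Option α} {r : α} (h : IsParent g r) {a : α} :
    g a = none ↔ a = r := by
  refine ⟨fun ha => ?_, fun ha => ha ▸ h.1⟩
  obtain ⟨j, hj⟩ := h.2 a
  cases j with
  | zero => simpa using hj
  | succ j => rw [step_iterate_succ_some, ha, step_iterate_none] at hj; cases hj

/-- The parent functions of trees in which every node has a number of preimages in `P` and no
node has a distance from the root in `K`. -/
def parentTrees (α : Type*) (P K : Set ℕ) : Set ((α → Option α) × α) :=
  {p | IsParent p.1 p.2 ∧ (∀ y, (p.1 ⁻¹' {some y}).ncard ∈ P) ∧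
    ∀ j ∈ K, ∀ a, (step p.1)^[j] (some a) ≠ some p.2}

theorem step_iterate_conj (e : α ≃ β) (f : α → Option α) (j : ℕ) (o : Option α) :
    (step (e.arrowCongr e.optionCongr f))^[j] (o.map e) = ((step f)^[j] o).map e := by
  refine (Function.Semiconj.iterate_right (f := Option.map e) (fun o => ?_) j o).symm
  cases o <;> simp

theorem step_iterate_conj_eq_some (e : α ≃ β) (f : α → Option α) (j : ℕ) (a b : α) :
    (step (e.arrowCongr e.optionCongr f))^[j] (some (e a)) = some (e b) ↔
      (step f)^[j] (some a) = some b := by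
  rw [← Option.map_some, step_iterate_conj, ← Option.map_some,
    (Option.map_injective e.injective).eq_iff]

theorem card_parentTrees_congr (e : α ≃ β) (P K : Set ℕ) :
    Nat.card (parentTrees α P K) = Nat.card (parentTrees β P K) := by
  refine Nat.card_congr (((e.arrowCongr e.optionCongr).prodCongr e).subtypeEquiv ?_)
  rintro ⟨f, r⟩
  simp only [parentTrees, IsParent, Set.mem_ofPred_eq, Equiv.prodCongr_apply, Prod.map, ne_eq,
    e.symm.forall_congr_left, Equiv.symm_symm, step_iterate_conj_eq_some]
  refine and_congr (and_congr_left' ?_) (and_congr_left' (forall_congr' fun y => ?_))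
  · simp
  · have : (e.arrowCongr e.optionCongr f) ⁻¹' {some (e y)} = e '' (f ⁻¹' {some y}) := by
      ext b
      obtain ⟨a, rfl⟩ := e.surjective b
      simp
    rw [this, Set.ncard_image_of_injective _ e.injective]

end Iterates

/-! ### Attaching a tree to a partial function -/

section Glue

variable {α : Type*} {S : Finset α}

open Classical in
/-- The partial function that agrees with `g` on `S` and with `f` off `S`, where the points of
`S` on which `g` is undefined are sent to `o`. -/
noncomputable def glue (g : S → Option S) (f : {a // a ∉ S} → Option {a // a ∉ S})
    (o : Option {a // a ∉ S}) (a : α) : Option α :=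
  if h : a ∈ S then (g ⟨a, h⟩).elim (o.map Subtype.val) fun b => some b.1
  else (f ⟨a, h⟩).map Subtype.val

variable {g : S → Option S} {f : {a // a ∉ S} → Option {a // a ∉ S}} {o : Option {a // a ∉ S}}

theorem glue_eq_some_mem {a : α} {b : S} :
    glue g f o a = some b.1 ↔ ∃ h : a ∈ S, g ⟨a, h⟩ = some b := by
  by_cases h : a ∈ S
  · rcases hg : g ⟨a, h⟩ with _ | c
    · rcases o with _ | c
      · simp [glue, h, hg]
      · have : c.1 ≠ b.1 := fun hcb => c.2 (hcb ▸ b.2)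
        simp [glue, h, hg, this]
    · simp [glue, h, hg]
  · rcases hf : f ⟨a, h⟩ with _ | c
    · simp [glue, h, hf]
    · have : c.1 ≠ b.1 := fun hcb => c.2 (hcb ▸ b.2)
      simp [glue, h, hf, this]

theorem glue_eq_some_notMem {a : α} {b : {a // a ∉ S}} :
    glue g f o a = some b.1 ↔
      (∃ h : a ∈ S, g ⟨a, h⟩ = none ∧ o = some b) ∨ ∃ h : a ∉ S, f ⟨a, h⟩ = some b := by
  by_cases h : a ∈ S
  · rcases hg : g ⟨a, h⟩ with _ | c
    · cases o <;> simp [glue, h, hg, Subtype.ext_iff]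
    · have : c.1 ≠ b.1 := fun hcb => b.2 (hcb ▸ c.2)
      simp [glue, h, hg, this]
  · rcases hf : f ⟨a, h⟩ with _ | c <;> simp [glue, h, hf, Subtype.ext_iff]

theorem glue_eq_none {a : α} :
    glue g f o a = none ↔
      (∃ h : a ∈ S, g ⟨a, h⟩ = none ∧ o = none) ∨ ∃ h : a ∉ S, f ⟨a, h⟩ = none := by
  by_cases h : a ∈ S
  · rcases hg : g ⟨a, h⟩ with _ | c <;> simp [glue, h, hg]
  · simp [glue, h]

/-- Nothing outside S is ever sent into S, so an orbit ending in S stays in S throughout and follows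
g. -/
theorem step_glue_iterate_eq_some (j : ℕ) {a : α} {b : S} :
    (step (glue g f o))^[j] (some a) = some b.1 ↔
      ∃ h : a ∈ S, (step g)^[j] (some ⟨a, h⟩) = some b := by
  induction j generalizing b with
  | zero =>
    constructor
    · intro h
      have h : a = b.1 := by simpa using h
      subst h
      exact ⟨b.2, rfl⟩
    · rintro ⟨h, hb⟩
      have hb : (⟨a, h⟩ : S) = b := by simpa using hb
      rw [← hb]; rfl
  | succ j ih =>
    simp only [step_iterate_succ_eq_some]
    constructor
    · rintro ⟨c, hc, hcb⟩
      obtain ⟨hcS, hg⟩ := glue_eq_some_mem.1 hcb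
      obtain ⟨h, h'⟩ := (ih (b := ⟨c, hcS⟩)).1 hc
      exact ⟨h, _, h', hg⟩
    · rintro ⟨h, c, hc, hcb⟩
      exact ⟨c, ih.2 ⟨h, hc⟩, glue_eq_some_mem.2 ⟨c.2, hcb⟩⟩

theorem glue_root {r : S} (hr : g r = none) : glue g f o r = o.map Subtype.val := by
  simp [glue, hr]

theorem ncard_glue_preimage_mem (b : S) :
    (glue g f o ⁻¹' {some b.1}).ncard = (g ⁻¹' {some b}).ncard := by
  have : glue g f o ⁻¹' {some b.1} = Subtype.val '' (g ⁻¹' {some b}) := by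
    ext a
    simp [glue_eq_some_mem]
  rw [this, Set.ncard_image_of_injective _ Subtype.val_injective]

open Classical in
theorem ncard_glue_preimage_notMem [Finite α] {r : S} (hg : IsParent g r) (b : {a // a ∉ S}) :
    (glue g f o ⁻¹' {some b.1}).ncard =
      (f ⁻¹' {some b}).ncard + if o = some b then 1 else 0 := by
  have hf : glue g f o ⁻¹' {some b.1} =
      Subtype.val '' (f ⁻¹' {some b}) ∪ if o = some b then {r.1} else ∅ := by
    ext a
    rw [Set.mem_preimage, Set.mem_singleton_iff, glue_eq_some_notMem, or_comm]
    simp only [hg.eq_none_iff]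
    refine or_congr (by simp) ?_
    split_ifs with ho
    · constructor
      · rintro ⟨h, h', -⟩; rw [← h']; rfl
      · rintro rfl; exact ⟨r.2, rfl, ho⟩
    · simp [ho]
  rw [hf, Set.ncard_union_eq, Set.ncard_image_of_injective _ Subtype.val_injective]
  · split_ifs <;> simp
  · rw [Set.disjoint_left]
    rintro _ ⟨c, -, rfl⟩
    split_ifs
    · exact fun h => c.2 ((Set.mem_singleton_iff.1 h) ▸ r.2)
    · simp

/-- Whether the root is undefined depends on o alone; discarding it leaves exactly the undefined
points of f. -/
theorem ncard_glue_preimage_none {r : S} (hg : IsParent g r) :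
    (glue g f o ⁻¹' {none} \ {r.1}).ncard = (f ⁻¹' {none}).ncard := by
  have : glue g f o ⁻¹' {none} \ {r.1} = Subtype.val '' (f ⁻¹' {none}) := by
    ext a
    rw [Set.mem_sdiff, Set.mem_preimage, Set.mem_singleton_iff, glue_eq_none]
    simp only [hg.eq_none_iff, Set.mem_image, Set.mem_preimage, Set.mem_singleton_iff,
      Subtype.exists, exists_and_right, exists_eq_right]
    constructor
    · rintro ⟨⟨⟨h, h'⟩, -⟩ | h, hr⟩
      · exact absurd (congrArg Subtype.val h') hr
      · exact h
    · rintro ⟨h, h'⟩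
      exact ⟨Or.inr ⟨h, h'⟩, fun hr => h (hr ▸ r.2)⟩
  rw [this, Set.ncard_image_of_injective _ Subtype.val_injective]

end Glue

/-! ### Cutting off the tree above a noncyclic point -/

section Branches

variable {α : Type*}

/-- The pairs of a partial function with constrained fibers and a point `x` that lies on no
cycle and is the image of no point under the `j`th iterate for `j ∈ K`. -/
def branches (α : Type*) (P Q K : Set ℕ) (s : Bool) : Set ((α → Option α) × α) :=
  {p | (∀ j, (step p.1)^[j + 1] (some p.2) ≠ some p.2) ∧
    (∀ y, (p.1 ⁻¹' {some y}).ncard ∈ P) ∧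
    (∀ j ∈ K, ∀ a, (step p.1)^[j] (some a) ≠ some p.2) ∧
    (p.1 ⁻¹' {none} \ {p.2}).ncard ∈ Q ∧ (p.1 p.2).isSome = s}

open Classical in
/-- The partial functions together with a place where a branch may be attached. -/
def pruned (γ : Type*) (P Q : Set ℕ) (s : Bool) : Set ((γ → Option γ) × Option γ) :=
  {p | (p.1 ⁻¹' {none}).ncard ∈ Q ∧
    (∀ y, (p.1 ⁻¹' {some y}).ncard + (if p.2 = some y then 1 else 0) ∈ P) ∧ p.2.isSome = s}

open Classical in
/-- The points that are sent to `x` by an iterate. -/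
noncomputable def descendants [Fintype α] (f : α → Option α) (x : α) : Finset α :=
  Finset.univ.filter fun a => ∃ j, (step f)^[j] (some a) = some x

theorem mem_descendants [Fintype α] {f : α → Option α} {a x : α} :
    a ∈ descendants f x ↔ ∃ j, (step f)^[j] (some a) = some x := by
  simp [descendants]

theorem descendants_glue [Fintype α] {S : Finset α} {g : S → Option S}
    {f : {a // a ∉ S} → Option {a // a ∉ S}} {o : Option {a // a ∉ S}} {r : S}
    (hg : IsParent g r) : descendants (glue g f o) r.1 = S := by
  ext a
  simp only [mem_descendants, step_glue_iterate_eq_some]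
  exact ⟨fun ⟨_, h, _⟩ => h, fun h => (hg.2 ⟨a, h⟩).imp fun j hj => ⟨h, hj⟩⟩

theorem glue_mem_branches_iff [Finite α] {P Q K : Set ℕ} {s : Bool} {S : Finset α}
    {g : S → Option S} {f : {a // a ∉ S} → Option {a // a ∉ S}} {o : Option {a // a ∉ S}}
    {r : S} (hg : IsParent g r) :
    (glue g f o, r.1) ∈ branches α P Q K s ↔
      (g, r) ∈ parentTrees S P K ∧ (f, o) ∈ pruned {a // a ∉ S} P Q s := by
  have h1 : ∀ j, (step (glue g f o))^[j + 1] (some r.1) ≠ some r.1 := by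
    intro j h
    obtain ⟨_, h⟩ := (step_glue_iterate_eq_some (j + 1)).1 h
    rw [step_iterate_succ_some, hg.1, step_iterate_none] at h
    cases h
  have h2 : (∀ y, (glue g f o ⁻¹' {some y}).ncard ∈ P) ↔
      (∀ y : S, (glue g f o ⁻¹' {some y.1}).ncard ∈ P) ∧
        ∀ y : {a // a ∉ S}, (glue g f o ⁻¹' {some y.1}).ncard ∈ P :=
    ⟨fun h => ⟨fun y => h _, fun y => h _⟩, fun h y => by
      by_cases hy : y ∈ S
      exacts [h.1 ⟨y, hy⟩, h.2 ⟨y, hy⟩]⟩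
  have h3 : ∀ j, (∀ a, (step (glue g f o))^[j] (some a) ≠ some r.1) ↔
      ∀ a : S, (step g)^[j] (some a) ≠ some r := by
    intro j
    simp only [ne_eq, step_glue_iterate_eq_some, not_exists, Subtype.forall]
  simp only [branches, parentTrees, pruned, Set.mem_ofPred_eq, h2, h3,
    ncard_glue_preimage_mem, ncard_glue_preimage_notMem hg, ncard_glue_preimage_none hg,
    glue_root hg.1, Option.isSome_map]
  exact ⟨fun ⟨_, ⟨a, b⟩, c, d, e⟩ => ⟨⟨hg, a, c⟩, d, fun y => by convert b y, e⟩,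
    fun ⟨⟨_, a, c⟩, d, b, e⟩ => ⟨h1, ⟨a, fun y => by convert b y⟩, c, d, e⟩⟩

/-- The descendants of x are closed under preimages, and an orbit can leave them only at x. Since x
is on no cycle, f(x) is not a descendant, so f restricts to a tree on the descendants and a partial
function on the complement. -/
theorem exists_glue [Fintype α] {f : α → Option α} {x : α}
    (hx : ∀ j, (step f)^[j + 1] (some x) ≠ some x) :
    ∃ (g : descendants f x → Option (descendants f x)) (r : descendants f x)
      (f' : {a // a ∉ descendants f x} → Option {a // a ∉ descendants f x})
      (o : Option {a // a ∉ descendants f x}),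
      IsParent g r ∧ r.1 = x ∧ glue g f' o = f := by
  classical
  have hxS : x ∈ descendants f x := mem_descendants.2 ⟨0, rfl⟩
  have hback : ∀ a b, f a = some b → b ∈ descendants f x → a ∈ descendants f x := by
    intro a b hab hb
    obtain ⟨j, hj⟩ := mem_descendants.1 hb
    exact mem_descendants.2 ⟨j + 1, by rw [step_iterate_succ_some, hab, hj]⟩
  have hforw : ∀ a ∈ descendants f x, a ≠ x → ∃ b ∈ descendants f x, f a = some b := by
    intro a ha hax
    obtain ⟨j, hj⟩ := mem_descendants.1 ha
    cases j with
    | zero => exact absurd (by simpa using hj) hax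
    | succ j =>
      rw [step_iterate_succ_some] at hj
      rcases hfa : f a with _ | b
      · rw [hfa, step_iterate_none] at hj; cases hj
      · exact ⟨b, mem_descendants.2 ⟨j, hfa ▸ hj⟩, rfl⟩
  have hfx : ∀ b, f x = some b → b ∉ descendants f x := by
    intro b hb hbS
    obtain ⟨j, hj⟩ := mem_descendants.1 hbS
    exact hx j (by rw [step_iterate_succ_some, hb, hj])
  let g : descendants f x → Option (descendants f x) := fun a =>
    (f a).bind fun b => if h : b ∈ descendants f x then some ⟨b, h⟩ else none
  let q : α → Option {a // a ∉ descendants f x} := fun a =>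
    (f a).bind fun b => if h : b ∉ descendants f x then some ⟨b, h⟩ else none
  have hq : ∀ a, (∀ b, f a = some b → b ∉ descendants f x) →
      (q a).map Subtype.val = f a := by
    intro a ha
    rcases hfa : f a with _ | b
    · simp [q, hfa]
    · simp [q, hfa, ha b hfa]
  have hgx : g ⟨x, hxS⟩ = none := by
    rcases hfa : f x with _ | b
    · simp [g, hfa]
    · simp [g, hfa, hfx b hfa]
  have hglue : glue g (fun a => q a) (q x) = f := by
    funext a
    by_cases ha : a ∈ descendants f x
    · by_cases hax : a = x
      · subst hax
        rw [← hq a hfx]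
        exact glue_root (r := ⟨a, hxS⟩) hgx
      · obtain ⟨b, hb, hab⟩ := hforw a ha hax
        rw [hab]
        exact glue_eq_some_mem (b := ⟨b, hb⟩).2 ⟨ha, by simp [g, hab, hb]⟩
    · rw [← hq a fun b hb h => ha (hback a b hb h)]
      simp [glue, ha]
  refine ⟨g, ⟨x, hxS⟩, fun a => q a, q x, ⟨hgx, fun a => ?_⟩, rfl, hglue⟩
  obtain ⟨j, hj⟩ := mem_descendants.1 a.2
  obtain ⟨h, h'⟩ := (step_glue_iterate_eq_some (b := ⟨x, hxS⟩) j).1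
    ((congrArg (fun f => (step f)^[j] (some a.1)) hglue).trans hj)
  exact ⟨j, h'⟩

theorem glue_injective {S : Finset α} {g g' : S → Option S}
    {f f' : {a // a ∉ S} → Option {a // a ∉ S}} {o o' : Option {a // a ∉ S}} {r : S}
    (hr : g r = none) (hr' : g' r = none) (h : glue g f o = glue g' f' o') :
    g = g' ∧ f = f' ∧ o = o' := by
  have hval := Option.map_injective (Subtype.val_injective (p := fun a => a ∉ S))
  refine ⟨?_, ?_, ?_⟩
  · funext a
    ext b
    have h1 := glue_eq_some_mem (g := g) (f := f) (o := o) (a := a.1) (b := b)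
    have h2 := glue_eq_some_mem (g := g') (f := f') (o := o') (a := a.1) (b := b)
    rw [← h] at h2
    simpa using h1.symm.trans h2
  · funext a
    have := congrFun h a.1
    simp only [glue, a.2, dif_neg, not_false_eq_true] at this
    exact hval this
  · have := congrFun h r.1
    rw [glue_root hr, glue_root hr'] at this
    exact hval this

theorem card_branches_fiber [Fintype α] (P Q K : Set ℕ) (s : Bool) (S : Finset α) :
    Nat.card {p : branches α P Q K s // descendants p.1.1 p.1.2 = S} =
      Nat.card (parentTrees S P K) * Nat.card (pruned {a // a ∉ S} P Q s) := by
  rw [← Nat.card_prod]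
  symm
  refine Nat.card_congr (Equiv.ofBijective (fun q => ⟨⟨(glue q.1.1.1 q.2.1.1 q.2.1.2, q.1.1.2.1),
    (glue_mem_branches_iff q.1.2.1).2 ⟨q.1.2, q.2.2⟩⟩, descendants_glue q.1.2.1⟩) ⟨?_, ?_⟩)
  · rintro ⟨⟨⟨g, r⟩, hg⟩, ⟨⟨f, o⟩, hf⟩⟩ ⟨⟨⟨g', r'⟩, hg'⟩, ⟨⟨f', o'⟩, hf'⟩⟩ h
    simp only [Subtype.mk.injEq, Prod.mk.injEq] at h
    obtain ⟨h, hr⟩ := h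
    obtain rfl := Subtype.ext hr
    obtain ⟨rfl, rfl, rfl⟩ := glue_injective hg.1.1 hg'.1.1 h
    rfl
  · rintro ⟨⟨⟨f, x⟩, hp⟩, rfl⟩
    obtain ⟨g, r, f', o, hg, hr, h⟩ := exists_glue hp.1
    have := (glue_mem_branches_iff hg).1 ((Prod.ext h hr : (glue g f' o, r.1) = (f, x)) ▸ hp)
    exact ⟨⟨⟨_, this.1⟩, ⟨_, this.2⟩⟩, Subtype.ext (Subtype.ext (Prod.ext h hr))⟩

end Branches

/-! ### Rooted trees as graphs versus parent functions -/

theorem exists_adj_dist_eq {V : Type*} {G : SimpleGraph V} (hG : G.Connected) {u v : V} {m : ℕ}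
    (h : G.dist u v = m + 1) : ∃ w, G.Adj v w ∧ G.dist u w = m := by
  obtain ⟨p, hp⟩ := hG.exists_walk_length_eq_dist v u
  rw [SimpleGraph.dist_comm, h] at hp
  cases p with
  | nil => simp at hp
  | @cons _ w _ hvw q =>
    refine ⟨w, hvw, le_antisymm ?_ ?_⟩
    · rw [SimpleGraph.dist_comm]
      refine (SimpleGraph.dist_le q).trans ?_
      simpa using hp.le
    · have h1 : G.dist u v ≤ G.dist u w + G.dist w v := hG.dist_triangle
      rw [SimpleGraph.dist_eq_one_iff_adj.2 hvw.symm] at h1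
      omega

theorem exists_dist_eq_of_le {V : Type*} {G : SimpleGraph V} (hG : G.Connected) {u v : V} {k : ℕ}
    (h : k ≤ G.dist u v) : ∃ w, G.dist u w = k := by
  obtain ⟨m, hm⟩ := Nat.exists_eq_add_of_le h
  induction m generalizing v with
  | zero => exact ⟨v, hm⟩
  | succ m ih =>
    obtain ⟨w, -, hw⟩ := exists_adj_dist_eq hG (m := k + m) hm
    exact ih (by omega) hw

section ParentGraph

variable {α : Type*}

/-- The graph that joins every node to its parent. -/
def parentGraph (g : α → Option α) : SimpleGraph α :=
  SimpleGraph.fromRel fun a b => g a = some b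

variable {g : α → Option α} {r : α}

theorem IsParent.iterate_unique (h : IsParent g r) {i j : ℕ} {a : α}
    (hi : (step g)^[i] (some a) = some r) (hj : (step g)^[j] (some a) = some r) : i = j := by
  wlog hij : i ≤ j generalizing i j
  · exact (this hj hi (le_of_not_ge hij)).symm
  obtain ⟨m, rfl⟩ := Nat.exists_eq_add_of_le hij
  cases m with
  | zero => rfl
  | succ m =>
    rw [add_comm, Function.iterate_add_apply, hi, step_iterate_succ_some, h.1,
      step_iterate_none] at hj
    cases hj

theorem IsParent.ne_self (h : IsParent g r) (a : α) : g a ≠ some a := by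
  intro ha
  obtain ⟨j, hj⟩ := h.2 a
  have : (step g)^[j + 1] (some a) = some r := by rw [step_iterate_succ_some, ha, hj]
  exact absurd (h.iterate_unique hj this) (by omega)

theorem IsParent.parentGraph_adj (h : IsParent g r) {a b : α} :
    (parentGraph g).Adj a b ↔ g a = some b ∨ g b = some a := by
  rw [parentGraph, SimpleGraph.fromRel_adj, and_iff_right_iff_imp]
  rintro (hab | hab) rfl <;> exact h.ne_self _ hab

theorem IsParent.exists_walk (h : IsParent g r) {j : ℕ} {a : α}
    (hj : (step g)^[j] (some a) = some r) :
    ∃ p : (parentGraph g).Walk a r, p.length = j := by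
  induction j generalizing a with
  | zero =>
    obtain rfl : a = r := by simpa using hj
    exact ⟨.nil, rfl⟩
  | succ j ih =>
    rw [step_iterate_succ_some] at hj
    rcases hb : g a with _ | b
    · rw [hb, step_iterate_none] at hj; cases hj
    · obtain ⟨p, hp⟩ := ih (hb ▸ hj)
      exact ⟨.cons (h.parentGraph_adj.2 (Or.inl hb)) p, by simp [hp]⟩

theorem IsParent.connected (h : IsParent g r) : (parentGraph g).Connected := by
  have hr : ∀ a, (parentGraph g).Reachable a r := fun a =>
    let ⟨_, hj⟩ := h.2 a
    (h.exists_walk hj).choose.reachable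
  exact { preconnected := fun a b => (hr a).trans (hr b).symm, nonempty := ⟨r⟩ }

/-- The number of steps to the root changes by one along each edge, so no walk to the root is
shorter than the chain of parents. -/
theorem IsParent.dist_eq_iff (h : IsParent g r) {j : ℕ} {a : α} :
    (parentGraph g).dist r a = j ↔ (step g)^[j] (some a) = some r := by
  choose d hd using h.2
  have hstep : ∀ a b, g a = some b → d a = d b + 1 := fun a b hab =>
    h.iterate_unique (hd a) (by rw [step_iterate_succ_some, hab, hd])
  have hwalk : ∀ u v (p : (parentGraph g).Walk u v), d u ≤ d v + p.length := by
    intro u v p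
    induction p with
    | nil => simp
    | cons huv p ih =>
      rw [SimpleGraph.Walk.length_cons]
      rcases h.parentGraph_adj.1 huv with h' | h' <;> have := hstep _ _ h' <;> omega
  have hr : d r = 0 := h.iterate_unique (hd r) rfl
  have hdist : (parentGraph g).dist r a = d a := by
    rw [SimpleGraph.dist_comm]
    obtain ⟨p, hp⟩ := h.exists_walk (hd a)
    obtain ⟨q, hq⟩ := h.connected.exists_walk_length_eq_dist a r
    refine le_antisymm (hp ▸ SimpleGraph.dist_le p) ?_
    have := hwalk _ _ q
    omega
  rw [hdist]
  exact ⟨fun hj => hj ▸ hd a, fun hj => h.iterate_unique (hd a) hj⟩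

theorem IsParent.dist_of_eq_some (h : IsParent g r) {a b : α} (hab : g a = some b) :
    (parentGraph g).dist r a = (parentGraph g).dist r b + 1 := by
  rw [h.dist_eq_iff, step_iterate_succ_some, hab, ← h.dist_eq_iff]

theorem IsParent.adj_and_dist_lt_iff (h : IsParent g r) {a b : α} :
    ((parentGraph g).Adj a b ∧ (parentGraph g).dist r b < (parentGraph g).dist r a) ↔
      g a = some b := by
  rw [h.parentGraph_adj]
  constructor
  · rintro ⟨hab | hab, hlt⟩
    · exact hab
    · have := h.dist_of_eq_some hab
      omega
  · intro hab
    exact ⟨Or.inl hab, by rw [h.dist_of_eq_some hab]; omega⟩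

/-- A connected graph is a tree once it has few enough edges; here each edge comes from a non-root
node and its parent. -/
theorem IsParent.isTree [Finite α] (h : IsParent g r) : (parentGraph g).IsTree := by
  rw [SimpleGraph.isTree_iff_connected_and_card]
  refine ⟨h.connected, le_antisymm ?_ h.connected.card_vert_le_card_edgeSet_add_one⟩
  -- The default of `getD` is never used, as g is undefined only at the excluded root.
  have hsub : (parentGraph g).edgeSet ⊆ (fun a => s(a, (g a).getD a)) '' {r}ᶜ := by
    intro e
    induction e with
    | _ a b =>
      have key : ∀ a b, g a = some b → s(a, b) ∈ (fun a => s(a, (g a).getD a)) '' {r}ᶜ := by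
        intro a b hab
        refine ⟨a, ?_, by simp [hab]⟩
        rintro rfl
        rw [h.1] at hab
        cases hab
      rw [SimpleGraph.mem_edgeSet, h.parentGraph_adj]
      rintro (hab | hab)
      · exact key a b hab
      · rw [Sym2.eq_swap]; exact key b a hab
  have h1 : Nat.card (parentGraph g).edgeSet ≤ ({r}ᶜ : Set α).ncard :=
    (Set.ncard_le_ncard hsub (Set.toFinite _)).trans (Set.ncard_image_le (Set.toFinite _))
  have h2 := Set.ncard_add_ncard_compl ({r} : Set α)
  rw [Set.ncard_singleton] at h2
  omega

/-- Each non-root node chooses a neighbour one step closer to the root. The resulting graph is a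
connected subgraph of G, hence all of G, a tree being minimally connected. -/
theorem exists_isParent {G : SimpleGraph α} (hG : G.IsTree) (r : α) :
    ∃ g, IsParent g r ∧ parentGraph g = G := by
  classical
  have hex : ∀ a, ∃ b, a ≠ r → G.Adj a b ∧ G.dist r a = G.dist r b + 1 := by
    intro a
    by_cases ha : a = r
    · exact ⟨a, fun h => absurd ha h⟩
    · obtain ⟨m, hm⟩ := Nat.exists_eq_succ_of_ne_zero
        (hG.connected.pos_dist_of_ne (Ne.symm ha)).ne'
      obtain ⟨w, hw, hd⟩ := exists_adj_dist_eq hG.connected hm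
      exact ⟨w, fun _ => ⟨hw, by rw [hm, hd]⟩⟩
  choose b hb using hex
  let g : α → Option α := fun a => if a = r then none else some (b a)
  have hg : IsParent g r := by
    refine ⟨if_pos rfl, fun a => ⟨G.dist r a, ?_⟩⟩
    generalize hm : G.dist r a = m
    induction m generalizing a with
    | zero => rw [← hG.connected.dist_eq_zero_iff.1 hm]; rfl
    | succ m ih =>
      have ha : a ≠ r := by rintro rfl; simp at hm
      rw [step_iterate_succ_some, show g a = some (b a) from if_neg ha]
      exact ih _ (by have := (hb a ha).2; omega)
  have hle : parentGraph g ≤ G := by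
    have key : ∀ x y, g x = some y → G.Adj x y := by
      intro x y hxy
      by_cases hx : x = r
      · simp [g, hx] at hxy
      · obtain rfl : b x = y := by simpa [g, hx] using hxy
        exact (hb x hx).1
    intro x y hxy
    rcases hg.parentGraph_adj.1 hxy with h | h
    · exact key x y h
    · exact (key y x h).symm
  exact ⟨g, hg, le_antisymm hle
    ((SimpleGraph.isTree_iff_minimal_connected.1 hG).2 hg.connected hle)⟩

end ParentGraph

theorem card_parentTrees (n : ℕ) (P K : Set ℕ) :
    Nat.card (parentTrees (Fin n) P K) =
      Nat.card {t : RootedTree n // t.Constrained P ∧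
        ∀ j ∈ K, ∀ a, t.graph.dist t.root a ≠ j} := by
  have hpre : ∀ (g : Fin n → Option (Fin n)) (r : Fin n) (h : IsParent g r) (b : Fin n),
      (RootedTree.mk (parentGraph g) h.isTree r).preimages b = g ⁻¹' {some b} := by
    intro g r h b
    ext a
    exact h.adj_and_dist_lt_iff
  have hiff : ∀ (g : Fin n → Option (Fin n)) (r : Fin n) (h : IsParent g r),
      (g, r) ∈ parentTrees (Fin n) P K ↔
        (RootedTree.mk (parentGraph g) h.isTree r).Constrained P ∧
          ∀ j ∈ K, ∀ a, (parentGraph g).dist r a ≠ j := by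
    intro g r h
    simp only [parentTrees, Set.mem_ofPred_eq, RootedTree.Constrained, hpre, ne_eq, h.dist_eq_iff,
      h, true_and]
  refine Nat.card_congr (Equiv.ofBijective (fun p =>
    ⟨⟨parentGraph p.1.1, p.2.1.isTree, p.1.2⟩, (hiff _ _ p.2.1).1 p.2⟩) ⟨?_, ?_⟩)
  · rintro ⟨⟨g, r⟩, hg⟩ ⟨⟨g', r'⟩, hg'⟩ h
    simp only [Subtype.mk.injEq, RootedTree.mk.injEq] at h
    obtain ⟨h, rfl⟩ := h
    have : g = g' := by
      funext a
      ext b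
      rw [← hg.1.adj_and_dist_lt_iff, ← hg'.1.adj_and_dist_lt_iff, h]
    subst this
    rfl
  · rintro ⟨⟨G, hG, r⟩, ht⟩
    obtain ⟨g, hg, rfl⟩ := exists_isParent hG r
    exact ⟨⟨(g, r), (hiff g r hg).2 ht⟩, rfl⟩

/-- The distances that occur form an initial segment of ℕ, so avoiding k alone bounds them all. This
makes the height bound match the condition K = {k}. -/
theorem RootedTree.height_le_iff {n : ℕ} (t : RootedTree n) (k : ℕ) :
    (t.height : ℤ) ≤ (k : ℤ) - 1 ↔ ∀ a, t.graph.dist t.root a ≠ k := by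
  have h : (t.height : ℤ) ≤ (k : ℤ) - 1 ↔ t.height < k := by omega
  have := t.isTree.connected.nonempty
  rw [h]
  constructor
  · intro h a
    exact ((Finset.le_sup (f := fun a => t.graph.dist t.root a) (Finset.mem_univ a)).trans_lt h).ne
  · intro h
    by_contra! hk
    obtain ⟨a, -, ha⟩ := Finset.exists_mem_eq_sup _ (Finset.univ_nonempty (α := Fin n))
      fun a => t.graph.dist t.root a
    rw [RootedTree.height, ha] at hk
    obtain ⟨w, hw⟩ := exists_dist_eq_of_le t.isTree.connected hk
    exact h w hw

/-! ### Counting branches, and the functional equation of T^P -/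

variable {R : Type*} [CommRing R] [Algebra ℚ R]

theorem treeGF_eq_egf (P : Set ℕ) :
    treeGF R P = egf fun n => (Nat.card (parentTrees (Fin n) P ∅) : R) := by
  simp only [treeGF, egf, card_parentTrees, Set.mem_empty_iff_false, IsEmpty.forall_iff,
    implies_true, and_true]

theorem treeGFLe_eq_egf (P : Set ℕ) (k : ℕ) :
    treeGFLe R P ((k : ℤ) - 1) = egf fun n => (Nat.card (parentTrees (Fin n) P {k}) : R) := by
  simp only [treeGFLe, egf, card_parentTrees, RootedTree.height_le_iff, Set.mem_singleton_iff,
    forall_eq]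

section Counting

variable {R : Type*} [CommRing R] [Algebra ℚ R]

theorem card_pruned_false {γ : Type*} [Fintype γ] (P Q : Set ℕ) :
    (Nat.card (pruned γ P Q false) : R) = ((Fintype.card γ).factorial : R) *
      coeff (Fintype.card γ) (lagrange (ePS R P) (ePS R Q)) := by
  rw [← card_partial_fibers_mem]
  congr 1
  refine Nat.card_congr ⟨fun p => ⟨p.1.1, p.2.1, fun y => ?_⟩,
    fun f => ⟨(f.1, none), f.2.1, fun y => ?_, rfl⟩, ?_, fun _ => rfl⟩
  · obtain ⟨⟨f, o⟩, -, h, ho⟩ := p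
    obtain rfl : o = none := by simpa using ho
    simpa using h y
  · simpa using f.2.2 y
  · rintro ⟨⟨f, o⟩, -, h, ho⟩
    obtain rfl : o = none := by simpa using ho
    rfl

theorem card_pruned_true {γ : Type*} [Fintype γ] (P Q : Set ℕ) :
    (Nat.card (pruned γ P Q true) : R) = ((Fintype.card γ).factorial : R) *
      coeff (Fintype.card γ) (lagrangeDeriv (ePS R P) (ePS R Q)) := by
  classical
  rw [← card_partial_fibers_mem_pointed]
  congr 1
  symm
  refine Nat.card_congr (Equiv.ofBijective
    (fun p => ⟨(p.1.1, some p.1.2), p.2.1, fun y => ?_, rfl⟩) ⟨?_, ?_⟩)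
  · simpa using p.2.2 y
  · rintro ⟨⟨f, y⟩, h⟩ ⟨⟨f', y'⟩, h'⟩ hh
    simpa [Subtype.ext_iff] using hh
  · rintro ⟨⟨f, o⟩, hQ, h, ho⟩
    obtain ⟨y, rfl⟩ := Option.isSome_iff_exists.1 ho
    exact ⟨⟨(f, y), hQ, fun z => by simpa using h z⟩, rfl⟩

/-- Sorting the pairs by the descendant set S gives a binomial convolution, that is, a product of
exponential generating functions. -/
theorem card_branches (P Q K : Set ℕ) (s : Bool) {A : R⟦X⟧}
    (hA : ∀ (n : ℕ) (S : Finset (Fin n)), (Nat.card (pruned {a // a ∉ S} P Q s) : R) =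
      ((n - S.card).factorial : R) * coeff (n - S.card) A) (n : ℕ) :
    (Nat.card (branches (Fin n) P Q K s) : R) =
      (n.factorial : R) *
        coeff n ((egf fun m => (Nat.card (parentTrees (Fin m) P K) : R)) * A) := by
  rw [eq_egf_of_factorial_mul (A := A) fun m => rfl, factorial_mul_coeff_egf_mul,
    ← Nat.card_congr (Equiv.sigmaFiberEquiv
      fun p : branches (Fin n) P Q K s => descendants p.1.1 p.1.2), Nat.card_sigma]
  push_cast
  refine Finset.sum_congr rfl fun S _ => ?_
  rw [card_branches_fiber, card_parentTrees_congr (S.equivFin), Nat.cast_mul, hA]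

theorem card_notMem (n : ℕ) (S : Finset (Fin n)) : Fintype.card {a // a ∉ S} = n - S.card := by
  simp [Fintype.card_subtype_compl]

theorem card_branches_false (P Q K : Set ℕ) (n : ℕ) :
    (Nat.card (branches (Fin n) P Q K false) : R) = (n.factorial : R) *
      coeff n ((egf fun m => (Nat.card (parentTrees (Fin m) P K) : R)) *
        lagrange (ePS R P) (ePS R Q)) :=
  card_branches P Q K false (fun n S => by rw [card_pruned_false, card_notMem]) n

theorem card_branches_true (P Q K : Set ℕ) (n : ℕ) :
    (Nat.card (branches (Fin n) P Q K true) : R) = (n.factorial : R) *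
      coeff n ((egf fun m => (Nat.card (parentTrees (Fin m) P K) : R)) *
        lagrangeDeriv (ePS R P) (ePS R Q)) :=
  card_branches P Q K true (fun n S => by rw [card_pruned_true, card_notMem]) n

/-- Both sides count partial functions with exactly one undefined point: on the left, the tree of
that point is separated from a total function on the other points. -/
theorem treeGF_mul_lagrange (P : Set ℕ) :
    treeGF R P * lagrange (ePS R P) 1 = lagrange (ePS R P) X := by
  rw [treeGF_eq_egf]
  ext n
  apply eq_of_factorial_mul_eq (n := n)
  rw [← ePS_singleton_zero, ← ePS_singleton_one, ← card_branches_false]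
  have := card_partial_fibers_mem (R := R) (γ := Fin n) P {1}
  rw [Fintype.card_fin] at this
  rw [← this]
  congr 1
  have hx : ∀ p : (Fin n → Option (Fin n)) × Fin n, p ∈ branches (Fin n) P {0} ∅ false →
      p.1 ⁻¹' {none} = {p.2} := by
    rintro ⟨f, x⟩ ⟨-, -, -, h0, hx⟩
    have hx : f x = none := by simpa using hx
    have h0 : f ⁻¹' {none} \ {x} = ∅ := (Set.ncard_eq_zero (Set.toFinite _)).1 h0
    exact Set.Subset.antisymm (Set.sdiff_eq_empty.1 h0) (Set.singleton_subset_iff.2 hx)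
  refine Nat.card_congr (Equiv.ofBijective (fun p => ⟨p.1.1, ?_, p.2.2.1⟩) ⟨?_, ?_⟩)
  · rw [hx _ p.2]; simp
  · rintro ⟨⟨f, x⟩, h⟩ ⟨⟨f', x'⟩, h'⟩ hh
    obtain rfl : f = f' := congrArg Subtype.val hh
    have h1 := hx _ h
    obtain rfl : x = x' := Set.singleton_injective (h1.symm.trans (hx _ h'))
    rfl
  · rintro ⟨f, h1, hP⟩
    obtain ⟨x, hx⟩ := Set.ncard_eq_one.1 (Set.mem_singleton_iff.1 h1)
    have hfx : f x = none := by
      have : x ∈ f ⁻¹' {none} := by rw [hx]; rfl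
      exact this
    refine ⟨⟨(f, x), fun j => ?_, hP, fun j hj => absurd hj (Set.notMem_empty j), ?_, ?_⟩, rfl⟩
    · simp [step_iterate_succ_some, hfx]
    · simp [hx]
    · simp [hfx]

theorem treeGF_fixed (P : Set ℕ) :
    treeGF R P = X * ((ePS R P).subst (treeGF R P) : R⟦X⟧) := by
  obtain ⟨T, hT⟩ := exists_fixed (ePS R P)
  have h : treeGF R P = T := by
    apply (isUnit_lagrange_one (ePS R P)).mul_right_cancel
    rw [treeGF_mul_lagrange, lagrange_eq hT, subst_X (hasSubst_of_fixed hT)]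
  rw [h]
  exact hT

end Counting

/-! ### Points outside the image of an iterate -/

section Images

theorem partialIter_eq {n : ℕ} (f : Fin n → Option (Fin n)) (k : ℕ) (x : Fin n) :
    partialIter f k x = (step f)^[k] (some x) := by
  induction k with
  | zero => rfl
  | succ k ih => rw [Function.iterate_succ_apply', ← ih]; rfl

theorem step_iterate_some_comp {α : Type*} (f : α → α) (k : ℕ) (x : α) :
    (step fun a => some (f a))^[k] (some x) = some (f^[k] x) :=
  (Function.Semiconj.iterate_right (f := some) (ga := f) (fun _ => rfl) k x).symm

/-- A point on a cycle has preimages under every iterate. Hence the acyclicity demanded in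
`branches` is automatic for K = {k}. -/
theorem iterate_succ_ne_of_notMem_image {α : Type*} {f : α → Option α} {x : α} {k : ℕ}
    (h : ∀ a, (step f)^[k] (some a) ≠ some x) (j : ℕ) :
    (step f)^[j + 1] (some x) ≠ some x := by
  intro hj
  -- Going k times around the cycle takes k + jk steps, so x is the image of its jk-th iterate under
  -- the k-th iterate.
  have h1 : (step f)^[(j + 1) * k] (some x) = some x := by
    rw [Function.iterate_mul]
    exact Function.iterate_fixed hj k
  rw [Nat.add_mul, one_mul, add_comm, Function.iterate_add_apply] at h1
  rcases hc : (step f)^[j * k] (some x) with _ | c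
  · rw [hc, step_iterate_none] at h1; cases h1
  · exact h c (hc ▸ h1)

theorem mem_branches_singleton_iff {α : Type*} {P Q : Set ℕ} {k : ℕ} {s : Bool}
    {p : (α → Option α) × α} :
    p ∈ branches α P Q {k} s ↔ (∀ y, (p.1 ⁻¹' {some y}).ncard ∈ P) ∧
      (∀ a, (step p.1)^[k] (some a) ≠ some p.2) ∧
      (p.1 ⁻¹' {none} \ {p.2}).ncard ∈ Q ∧ (p.1 p.2).isSome = s := by
  simp only [branches, Set.mem_ofPred_eq, Set.mem_singleton_iff, forall_eq]
  exact ⟨fun h => h.2, fun h => ⟨iterate_succ_ne_of_notMem_image h.2.1, h⟩⟩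

theorem sum_ncard_compl {ι : Type*} [Fintype ι] {n : ℕ} (C : ι → Prop) [DecidablePred C]
    (A : ι → Set (Fin n)) :
    ∑ f with C f, (A f)ᶜ.ncard = Nat.card {p : ι × Fin n // C p.1 ∧ p.2 ∉ A p.1} := by
  rw [Finset.sum_subtype (p := C) (F := inferInstance) _ (by simp)]
  have e : {p : ι × Fin n // C p.1 ∧ p.2 ∉ A p.1} ≃
      Σ f : {f // C f}, ((A f.1)ᶜ : Set (Fin n)) :=
    ⟨fun p => ⟨⟨p.1.1, p.2.1⟩, p.1.2, p.2.2⟩, fun q => ⟨(q.1.1, q.2.1), q.1.2, q.2.2⟩,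
      fun _ => rfl, fun _ => rfl⟩
  rw [Nat.card_congr e, Nat.card_sigma]
  rfl

variable {R : Type*} [CommRing R] [Algebra ℚ R]

theorem eval_one {ι : Type*} (s : Finset ι) (m : ι → ℕ) (q : ℚ) :
    (algebraMap ℚ (Polynomial R) q * ∑ i ∈ s, Polynomial.X ^ m i).eval 1 =
      algebraMap ℚ R q * (s.card : R) := by
  rw [show algebraMap ℚ (Polynomial R) q = Polynomial.C (algebraMap ℚ R q) from rfl]
  simp only [Polynomial.eval_C_mul, Polynomial.eval_finsetSum, Polynomial.eval_X_pow, one_pow,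
    Finset.sum_const, nsmul_eq_mul, mul_one]

theorem eval_one_derivative {ι : Type*} (s : Finset ι) (m : ι → ℕ) (q : ℚ) :
    (Polynomial.derivative
      (algebraMap ℚ (Polynomial R) q * ∑ i ∈ s, Polynomial.X ^ m i)).eval 1 =
      algebraMap ℚ R q * ((∑ i ∈ s, m i : ℕ) : R) := by
  rw [show algebraMap ℚ (Polynomial R) q = Polynomial.C (algebraMap ℚ R q) from rfl]
  simp only [Polynomial.derivative_C_mul, Polynomial.derivative_sum, Polynomial.derivative_X_pow,
    Polynomial.eval_C_mul, Polynomial.eval_finsetSum, Polynomial.eval_X_pow, one_pow, mul_one,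
    Nat.cast_sum]

/-- Total functions are the partial functions with no undefined point other than x (Q = {0}) that
are also defined at x (s = true). -/
theorem Xi_eq_egf (k : ℕ) (P : Set ℕ) :
    Xi R k P = egf fun n => (Nat.card (branches (Fin n) P {0} {k} true) : R) := by
  classical
  ext n
  have h : Nat.card (branches (Fin n) P {0} {k} true) =
      ∑ f : Fin n → Fin n with FunConstrained P f, ((Set.range f^[k])ᶜ).ncard := by
    rw [sum_ncard_compl (FunConstrained P) fun f : Fin n → Fin n => Set.range f^[k]]
    symm
    refine Nat.card_congr (Equiv.ofBijective (fun p => ⟨(fun a => some (p.1.1 a), p.1.2),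
      mem_branches_singleton_iff.2 ⟨fun y => ?_, fun a ha => ?_, ?_, rfl⟩⟩) ⟨?_, ?_⟩)
    · have : (fun a => some (p.1.1 a)) ⁻¹' {some y} = p.1.1 ⁻¹' {y} := by ext; simp
      exact this ▸ p.2.1 y
    · rw [step_iterate_some_comp] at ha
      exact p.2.2 ⟨a, Option.some_injective _ ha⟩
    · have : (fun a => some (p.1.1 a)) ⁻¹' {none} = ∅ := by ext; simp
      simp [this]
    · rintro ⟨⟨f, x⟩, h⟩ ⟨⟨f', x'⟩, h'⟩ hh
      simp only [Subtype.mk.injEq, Prod.mk.injEq] at hh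
      obtain ⟨hf, rfl⟩ := hh
      obtain rfl : f = f' := funext fun a => Option.some_injective _ (congrFun hf a)
      rfl
    · rintro ⟨⟨g, x⟩, hp⟩
      obtain ⟨h1, h2, h3, h4⟩ := mem_branches_singleton_iff.1 hp
      have hsome : ∀ a, ∃ b, g a = some b := by
        intro a
        rw [← Option.ne_none_iff_exists']
        intro ha
        have h0 : g ⁻¹' {none} \ {x} = ∅ := (Set.ncard_eq_zero (Set.toFinite _)).1 h3
        obtain rfl : a = x := by
          by_contra hax
          exact (h0 ▸ (⟨ha, hax⟩ : a ∈ g ⁻¹' {none} \ {x}) : a ∈ (∅ : Set (Fin n)))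
        simp [ha] at h4
      choose f hf using hsome
      obtain rfl : g = fun a => some (f a) := funext hf
      refine ⟨⟨(f, x), fun y => ?_, ?_⟩, rfl⟩
      · have : (fun a => some (f a)) ⁻¹' {some y} = f ⁻¹' {y} := by ext; simp
        exact this ▸ h1 y
      · rintro ⟨a, ha⟩
        exact h2 a ((step_iterate_some_comp f k a).trans (congrArg some ha))
  simp only [Xi, evalOne, derivU, funGF, egf, coeff_map, coeff_mk, Polynomial.coe_evalRingHom,
    eval_one_derivative, h]

theorem XiPartial_eq_egf (k : ℕ) (P : Set ℕ) :
    XiPartial R k P = egf fun n => (Nat.card (branches (Fin n) P Set.univ {k} true) : R) +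
      Nat.card (branches (Fin n) P Set.univ {k} false) := by
  classical
  ext n
  have h : Nat.card (branches (Fin n) P Set.univ {k} true) +
      Nat.card (branches (Fin n) P Set.univ {k} false) =
      ∑ f : Fin n → Option (Fin n) with PartialConstrained P f, ((partialImage f k)ᶜ).ncard := by
    rw [sum_ncard_compl (PartialConstrained P)
      fun f : Fin n → Option (Fin n) => partialImage f k, Nat.card_coe_set_eq,
      Nat.card_coe_set_eq, ← Set.ncard_union_eq]
    · refine Nat.card_congr (Equiv.subtypeEquivRight fun p => ?_)
      rw [Set.mem_union, mem_branches_singleton_iff, mem_branches_singleton_iff]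
      simp only [partialImage, partialIter_eq, Set.mem_ofPred_eq, not_exists, PartialConstrained,
        Set.mem_univ, true_and]
      rcases (p.1 p.2).isSome <;> simp
    · rw [Set.disjoint_left]
      intro p h h'
      have h1 := (mem_branches_singleton_iff.1 h).2.2.2
      have h2 := (mem_branches_singleton_iff.1 h').2.2.2
      rw [h1] at h2
      cases h2
  rw [egf, coeff_mk, ← Nat.cast_add, h]
  simp only [XiPartial, evalOne, derivU, partialGF, coeff_map, coeff_mk,
    Polynomial.coe_evalRingHom, eval_one_derivative]

theorem funGFOne_eq_lagrange (P : Set ℕ) : funGFOne R P = lagrange (ePS R P) 1 := by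
  classical
  ext n
  apply eq_of_factorial_mul_eq (n := n)
  have h := card_fibers_mem (R := R) (ι := Fin n) (κ := Fin n) fun _ => P
  rw [Fintype.card_fin, Finset.prod_const, Finset.card_univ, Fintype.card_fin] at h
  change (Nat.card {f : Fin n → Fin n // FunConstrained P f} : R) = _ at h
  rw [coeff_lagrange, one_mul, ← h, Nat.card_eq_fintype_card, Fintype.card_subtype]
  have : coeff n (funGFOne R P) = algebraMap ℚ R (1 / n.factorial) *
      ((Finset.univ.filter fun f : Fin n → Fin n => FunConstrained P f).card : R) := by
    simp only [funGFOne, evalOne, funGF, coeff_map, coeff_mk, Polynomial.coe_evalRingHom,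
      eval_one]
  rw [this, ← mul_assoc, factorial_mul_algebraMap, one_mul]

end Images

end PreimageConstraint

theorem mainTheorem6 {R : Type*} [CommRing R] [Algebra ℚ R] (k : ℕ) (P : Set ℕ) :
    Xi R k P =
        (X : R⟦X⟧) * treeGFLe R P ((k : ℤ) - 1) *
          ((ePS R (shift P 2)).subst (treeGF R P) : R⟦X⟧) * funGFOne R P ^ 3 ∧
      XiPartial R k P =
        treeGFLe R P ((k : ℤ) - 1) * funGFOne R P ^ 2 *
          ((PowerSeries.exp R).subst (treeGF R P) : R⟦X⟧) *
          ((X : R⟦X⟧) * ((ePS R (shift P 2)).subst (treeGF R P) : R⟦X⟧) * funGFOne R P + 1) := by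
  have hT := treeGF_fixed (R := R) P
  have hM := lagrangeDeriv_one_eq hT
  have hF := lagrange_one_mul hT
  rw [derivative_derivative_ePS] at hM
  constructor
  · rw [Xi_eq_egf, treeGFLe_eq_egf, funGFOne_eq_lagrange,
      ← eq_egf_of_factorial_mul fun n => (card_branches_true P {0} {k} n).symm,
      ePS_singleton_zero, hM]
    ring
  · have h : XiPartial R k P = treeGFLe R P ((k : ℤ) - 1) *
        (lagrangeDeriv (ePS R P) (exp R) + lagrange (ePS R P) (exp R)) := by
      rw [XiPartial_eq_egf, treeGFLe_eq_egf, mul_add, ← ePS_univ]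
      refine (eq_egf_of_factorial_mul fun n => ?_).symm
      rw [map_add, mul_add, card_branches_true, card_branches_false]
    rw [h, funGFOne_eq_lagrange, lagrangeDeriv_eq hT, lagrange_eq hT (exp R), hM,
      show d⁄dX R (exp R) = exp R by rw [← ePS_univ, derivative_ePS]; rfl]
    generalize lagrange (ePS R P) 1 = F at *
    generalize treeGFLe R P ((k : ℤ) - 1) = t at *
    generalize ((ePS R (shift P 2)).subst (treeGF R P) : R⟦X⟧) = b at *
    generalize ((exp R).subst (treeGF R P) : R⟦X⟧) = e at *
    generalize ((d⁄dX R (ePS R P)).subst (treeGF R P) : R⟦X⟧) = a at *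
    -- The relation zφ'(T)F = F - 1 merges the terms zφ'(T)F² and F into F².
    linear_combination (-(t * e * F)) * hF
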